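/- For a set $S\subseteq\{0,1,2,\ldots\}$ let $\partial S=\{z\in S:\{z-1,z+1\}\not\subseteq S\}$ and let $\mathrm{per}(S)=\sum_{z\in\partial S}z$; for a finite $A\subseteq\{0,1,2,\ldots\}$ let $\mathrm{vol}(A)=\sum_{z\in A}z$ and $A^c=\{0,1,2,\ldots\}\setminus A$ (empty sums are $0$). For an integer $n\ge 0$ put \[ P(n)=\min\{\mathrm{per}(A):A\subseteq\{0,1,\ldots\}\text{ finite},\ \mathrm{vol}(A)=n\},\qquad Q(n)=\min\{\mathrm{per}(A^c):A\subseteq\{0,1,\ldots\}\text{ finite},\ \mathrm{vol}(A)=n\}, \] \[ f(n)=\left\lfloor\sqrt{2n}+\tfrac12\right\rfloor,\qquad g(n)=\frac{f(n)\,(f(n)+1)}{2}-n , \] so that $f(n)$ is the integer nearest to $\sqrt{2n}$ and $g(n)$ is a nonnegative integer. Let $g^i$ be the $i$-fold iterate of $g$ ($g^0(n)=n$), and let $\phi(n)$ be the smallest integer $i\ge 0$ with $g^{i}(n)\le 149{,}894$ (such an $i$ always exists). **Proposition.** For all integers $n\ge 0$, \[ P(n)=\begin{cases} P\bigl(g^{\phi(n)}(n)\bigr)+\sum_{i=1}^{\phi(n)}f\bigl(g^{i-1}(n)\bigr)+\dfrac{\phi(n)}{2}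 & \text{if }\phi(n)\text{ is even},\\[2mm] Q\bigl(g^{\phi(n)}(n)\bigr)+\sum_{i=1}^{\phi(n)}f\bigl(g^{i-1}(n)\bigr)+\dfrac{\phi(n)-1}{2} & \text{if }\phi(n)\text{ is odd}, \end{cases} \] and \[ Q(n)=\begin{cases} Q\bigl(g^{\phi(n)}(n)\bigr)+\sum_{i=1}^{\phi(n)}f\bigl(g^{i-1}(n)\bigr)+\dfrac{\phi(n)}{2} & \text{if }\phi(n)\text{ is even},\\[2mm] P\bigl(g^{\phi(n)}(n)\bigr)+\sum_{i=1}^{\phi(n)}f\bigl(g^{i-1}(n)\bigr)+\dfrac{\phi(n)+1}{2} & \text{if }\phi(n)\text{ is odd}. \end{cases} \] -/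

import Mathlib

namespace IntIso

/-- The boundary of `S ⊆ {0, 1, 2, …}`: the elements `z` of `S` for which `z - 1` and `z + 1` are not
both in `S`. The predecessor is taken in the integers, so `0` has no predecessor in `S`. -/
def boundary (S : Set ℕ) : Set ℕ :=
  {z | z ∈ S ∧ ¬ ((∃ y ∈ S, y + 1 = z) ∧ z + 1 ∈ S)}

/-- The perimeter of `S`: the sum of the elements of its boundary. It is only used for finite and
cofinite sets, whose boundaries are finite (see `finite_boundary` and `finite_boundary_compl`). -/
noncomputable def per (S : Set ℕ) : ℕ := ∑ᶠ z ∈ boundary S, z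

/-- The volume of a finite set of natural numbers: the sum of its elements. (An infinite set of
natural numbers has infinite volume, so only finite sets have a given volume `n`.) -/
def vol (A : Finset ℕ) : ℕ := ∑ z ∈ A, z

/-- `P n` is the minimum of `per A` over the sets `A ⊆ {0, 1, …}` of volume `n`. -/
noncomputable def P (n : ℕ) : ℕ :=
  sInf {m | ∃ A : Finset ℕ, vol A = n ∧ per (A : Set ℕ) = m}

/-- `Q n` is the minimum of `per Aᶜ` over the sets `A ⊆ {0, 1, …}` of volume `n`. -/
noncomputable def Q (n : ℕ) : ℕ :=
  sInf {m | ∃ A : Finset ℕ, vol A = n ∧ per ((A : Set ℕ)ᶜ) = m}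

/-- `f n = ⌊√(2n) + 1/2⌋`, the integer nearest to `√(2n)`. -/
noncomputable def f (n : ℕ) : ℕ := ⌊Real.sqrt (2 * (n : ℝ)) + 1 / 2⌋₊

/-- `g n = f(n)(f(n)+1)/2 - n`; the division is exact and the subtraction does not truncate, see
`g_add`. -/
noncomputable def g (n : ℕ) : ℕ := f n * (f n + 1) / 2 - n

/-- `phi N n` is the least `i ≥ 0` such that the `i`-fold iterate of `g` sends `n` to a number
`≤ N`. Such an `i` always exists, see `phi_isLeast`. -/
noncomputable def phi (N n : ℕ) : ℕ := sInf {i | g^[i] n ≤ N}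

theorem finite_boundary (A : Finset ℕ) : (boundary (A : Set ℕ)).Finite :=
  A.finite_toSet.subset fun _ hz => hz.1

theorem finite_boundary_compl (A : Finset ℕ) : (boundary ((A : Set ℕ)ᶜ)).Finite := by
  refine (((A.finite_toSet.image (· + 1)).union (A.finite_toSet.preimage
    ((add_left_injective 1).injOn (s := (fun x => x + 1) ⁻¹' (A : Set ℕ))))).union
    (Set.finite_singleton 0)).subset ?_
  rintro z ⟨-, hz⟩
  by_contra h
  simp only [Set.mem_union, Set.mem_image, Set.mem_preimage, Set.mem_singleton_iff, not_or,
    not_exists, not_and] at h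
  obtain ⟨⟨h1, h2⟩, h3⟩ := h
  exact hz ⟨⟨z - 1, fun hy => h1 _ hy (by omega), by omega⟩, h2⟩

theorem P_isLeast (n : ℕ) :
    IsLeast {m | ∃ A : Finset ℕ, vol A = n ∧ per (A : Set ℕ) = m} (P n) :=
  ⟨Nat.sInf_mem ⟨_, {n}, by simp [vol], rfl⟩, fun _ hm => Nat.sInf_le hm⟩

theorem Q_isLeast (n : ℕ) :
    IsLeast {m | ∃ A : Finset ℕ, vol A = n ∧ per ((A : Set ℕ)ᶜ) = m} (Q n) :=
  ⟨Nat.sInf_mem ⟨_, {n}, by simp [vol], rfl⟩, fun _ hm => Nat.sInf_le hm⟩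

theorem f_bounds (n : ℕ) : 2 * n ≤ f n * (f n + 1) ∧
    (0 < n → f n * f n < 2 * n + f n) := by
  have hs : Real.sqrt (2 * (n : ℝ)) ^ 2 = 2 * n := Real.sq_sqrt (by positivity)
  have h0 : 0 ≤ Real.sqrt (2 * (n : ℝ)) := Real.sqrt_nonneg _
  have h1 : (f n : ℝ) ≤ Real.sqrt (2 * (n : ℝ)) + 1 / 2 := Nat.floor_le (by positivity)
  have h2 : Real.sqrt (2 * (n : ℝ)) + 1 / 2 < f n + 1 := Nat.lt_floor_add_one _
  have hf : (0 : ℝ) ≤ f n := Nat.cast_nonneg _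
  constructor
  · have : (2 * n : ℝ) < f n * (f n + 1) + 1 := by nlinarith
    exact Nat.lt_succ_iff.1 (by exact_mod_cast this)
  · intro hn
    have hn' : (0 : ℝ) < n := by exact_mod_cast hn
    have : (f n * f n : ℝ) < 2 * n + f n := by
      rcases le_or_gt (f n : ℝ) (1 / 2) with h | h <;> nlinarith
    exact_mod_cast this

theorem g_add (n : ℕ) : 2 * (g n + n) = f n * (f n + 1) := by
  have h := (f_bounds n).1
  have he : 2 ∣ f n * (f n + 1) := (Nat.even_mul_succ_self (f n)).two_dvd
  unfold g
  omega

theorem g_lt {n : ℕ} (hn : 0 < n) : g n < n := by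
  have h := g_add n
  obtain ⟨h1, h2⟩ := f_bounds n
  have h2 := h2 hn
  by_contra! hc
  have h3 : n ≤ f n := by nlinarith
  have h4 : f n ≤ 2 := by nlinarith
  generalize f n = k at *
  interval_cases k <;> omega

theorem phi_isLeast (N n : ℕ) : IsLeast {i | g^[i] n ≤ N} (phi N n) := by
  refine ⟨Nat.sInf_mem ?_, fun _ hm => Nat.sInf_le hm⟩
  induction n using Nat.strong_induction_on with
  | _ n ih =>
    rcases Nat.eq_zero_or_pos n with rfl | hn
    · exact ⟨0, Nat.zero_le _⟩
    · obtain ⟨i, hi⟩ := ih _ (g_lt hn)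
      exact ⟨i + 1, hi⟩

end IntIso

namespace IntIso

/-! A nonempty `A` with maximum `k` is `{0, …, k} \ B` with `B ⊆ {0, …, k - 1}` and `vol A + vol B =
k(k+1)/2`. Then `per Aᶜ = k + 1 + per B`, and `per A = k + per Bᶜ` unless `k - 1 ∈ B`. The least
possible `k` is `f n`, which forces `vol B = g n`. So the formula is the iteration of `P n = f n + Q
(g n)` and `Q n = f n + 1 + P (g n)`, valid for `n > 149894` (`P_eq_of_lt`, `Q_eq_of_lt`).

The bounds `≤` are complementation. For `≥`, write `F = f n`, `G = g n`. A maximum `k > F` makes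
`vol B ≥ G + F + 1`, and since `f ≤ P` and `f < Q` this costs too much once `P G ≤ f (G + F + 1) +
1` and `Q G ≤ f (G + F + 1) + 2`. These bounds (`P_Q_le_f_add`) come from a finite table for small
`G` and from the linear bound `four_mul_le` for large `G`. If `k - 1 ∉ A`, then `k` is isolated and
the perimeter is nearly `2F`, again too much. -/

theorem per_eq_sum {S : Set ℕ} (h : (boundary S).Finite) : per S = ∑ z ∈ h.toFinset, z :=
  finsum_mem_eq_finite_toFinset_sum _ h

theorem per_le_of_subset {S T : Set ℕ} {k : ℕ} (hT : (boundary T).Finite)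
    (h : boundary S ⊆ insert k (boundary T)) : per S ≤ k + per T := by
  have hS : (boundary S).Finite := (hT.insert k).subset h
  rw [per_eq_sum hS, per_eq_sum hT]
  calc ∑ z ∈ hS.toFinset, z ≤ ∑ z ∈ insert k hT.toFinset, z := by
        apply Finset.sum_le_sum_of_subset
        intro z hz
        simpa using h (by simpa using hz)
    _ ≤ k + ∑ z ∈ hT.toFinset, z := by
        by_cases hk : k ∈ hT.toFinset
        · rw [Finset.insert_eq_of_mem hk]; omega
        · rw [Finset.sum_insert hk]

theorem per_eq_of_eq_insert {S T : Set ℕ} {k : ℕ} (hT : (boundary T).Finite)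
    (h : boundary S = insert k (boundary T)) (hk : k ∉ boundary T) : per S = k + per T := by
  unfold per
  rw [h, finsum_mem_insert _ hk hT]

theorem le_per {S : Set ℕ} (h : (boundary S).Finite) {z : ℕ} (hz : z ∈ boundary S) :
    z ≤ per S := by
  rw [per_eq_sum h]
  exact Finset.single_le_sum (f := fun z => z) (fun _ _ => Nat.zero_le _) (by simpa using hz)

theorem boundary_subset (S : Set ℕ) : boundary S ⊆ S := fun _ h => h.1

theorem per_coe_le_vol (A : Finset ℕ) : per (A : Set ℕ) ≤ vol A := by
  rw [per_eq_sum (finite_boundary A)]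
  exact Finset.sum_le_sum_of_subset fun z hz =>
    Finset.mem_coe.1 (boundary_subset _ ((finite_boundary A).mem_toFinset.1 hz))

/-- A computable description of the perimeter of a finite set. -/
theorem per_coe (A : Finset ℕ) :
    per (A : Set ℕ) = ∑ z ∈ A with ¬ ((∃ y ∈ A, y + 1 = z) ∧ z + 1 ∈ A), z := by
  rw [per_eq_sum (finite_boundary A)]
  congr 1
  ext z
  simp [boundary]

/-! ### Complementation inside an initial segment -/

theorem two_mul_vol_sdiff {k : ℕ} {B : Finset ℕ} (hB : B ⊆ Finset.range (k + 1)) :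
    2 * (vol (Finset.range (k + 1) \ B) + vol B) = k * (k + 1) := by
  unfold vol
  rw [Finset.sum_sdiff hB, mul_comm, Finset.sum_range_id_mul_two, mul_comm]
  rfl

/-- Removing from `{0, …, k}` a set `B` of smaller numbers, the complement gains only the boundary
point `k + 1`. -/
theorem per_compl_sdiff {k : ℕ} {B : Finset ℕ} (hB : B ⊆ Finset.range k) :
    per (((Finset.range (k + 1) \ B : Finset ℕ) : Set ℕ)ᶜ) = k + 1 + per (B : Set ℕ) := by
  have hlt : ∀ z ∈ B, z < k := fun z hz => Finset.mem_range.1 (hB hz)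
  refine per_eq_of_eq_insert (finite_boundary B) ?_ fun h => ?_
  · ext z
    simp only [boundary, Set.mem_ofPred_eq, Set.mem_compl_iff, Finset.mem_coe, Finset.mem_sdiff,
      Finset.mem_range, Set.mem_insert_iff]
    constructor
    · rintro ⟨h1, h2⟩
      by_cases hz : z ∈ B
      · refine Or.inr ⟨hz, ?_⟩
        rintro ⟨⟨y, hy, rfl⟩, h3⟩
        exact h2 ⟨⟨y, by tauto, rfl⟩, by tauto⟩
      · left
        by_contra hne
        have hlt' : k + 1 < z := by
          by_contra hc
          exact h1 ⟨by omega, hz⟩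
        exact h2 ⟨⟨z - 1, fun h => by omega, by omega⟩, fun h => by omega⟩
    · rintro (rfl | ⟨hz, h⟩)
      · refine ⟨by omega, ?_⟩
        rintro ⟨⟨y, hy, hyk⟩, -⟩
        have : y = k := by omega
        subst this
        exact hy ⟨by omega, fun h => (hlt _ h).false⟩
      · have := hlt z hz
        refine ⟨by tauto, ?_⟩
        rintro ⟨⟨y, hy, rfl⟩, h3⟩
        refine h ⟨⟨y, ?_, rfl⟩, ?_⟩
        · by_contra hc; exact hy ⟨by omega, hc⟩
        · by_contra hc; exact h3 ⟨by omega, hc⟩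
  · have := hlt _ (boundary_subset _ h)
    omega

theorem boundary_sdiff_subset {k : ℕ} {B : Finset ℕ} :
    boundary ((Finset.range (k + 1) \ B : Finset ℕ) : Set ℕ) ⊆
      insert k (boundary ((B : Set ℕ)ᶜ)) := by
  intro z
  simp only [boundary, Set.mem_ofPred_eq, Set.mem_compl_iff, Finset.mem_coe, Finset.mem_sdiff,
      Finset.mem_range, Set.mem_insert_iff]
  rintro ⟨⟨h1, h2⟩, h3⟩
  by_cases hz : z = k
  · exact Or.inl hz
  · refine Or.inr ⟨h2, ?_⟩
    rintro ⟨⟨y, hy, rfl⟩, h4⟩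
    exact h3 ⟨⟨y, ⟨by omega, hy⟩, rfl⟩, by omega, h4⟩

theorem per_sdiff_le {k : ℕ} {B : Finset ℕ} :
    per ((Finset.range (k + 1) \ B : Finset ℕ) : Set ℕ) ≤ k + per ((B : Set ℕ)ᶜ) :=
  per_le_of_subset (finite_boundary_compl B) boundary_sdiff_subset

/-- Since `k - 1` and `k + 1` are not in `B`, `k` is interior to `Bᶜ`, hence a genuinely new
boundary point. If `k - 1 ∈ B`, it would be counted already and only `per_sdiff_le` survives. -/
theorem per_sdiff {k : ℕ} {B : Finset ℕ} (hk : 0 < k) (hB : B ⊆ Finset.range (k - 1)) :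
    per ((Finset.range (k + 1) \ B : Finset ℕ) : Set ℕ) = k + per ((B : Set ℕ)ᶜ) := by
  have hlt : ∀ z ∈ B, z < k - 1 := fun z hz => Finset.mem_range.1 (hB hz)
  have hnot : ∀ z, k - 1 ≤ z → z ∉ B := fun z hz h => by have := hlt z h; omega
  refine per_eq_of_eq_insert (finite_boundary_compl B) ?_ ?_
  · refine boundary_sdiff_subset.antisymm ?_
    intro z
    simp only [boundary, Set.mem_ofPred_eq, Set.mem_compl_iff, Finset.mem_coe, Finset.mem_sdiff,
      Finset.mem_range, Set.mem_insert_iff]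
    rintro (rfl | ⟨h1, h2⟩)
    · exact ⟨⟨by omega, hnot _ (by omega)⟩, fun h => by omega⟩
    · have hz : z < k := by
        by_contra hc
        exact h2 ⟨⟨z - 1, hnot _ (by omega), by omega⟩, hnot _ (by omega)⟩
      refine ⟨⟨by omega, h1⟩, ?_⟩
      rintro ⟨⟨y, hy, rfl⟩, h4⟩
      exact h2 ⟨⟨y, hy.2, rfl⟩, h4.2⟩
  · rintro ⟨-, h⟩
    exact h ⟨⟨k - 1, hnot _ (by omega), by omega⟩, hnot _ (by omega)⟩

/-- An isolated maximum adds itself to the perimeter. -/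
theorem per_insert_of_lt {k : ℕ} {A : Finset ℕ} (hA : ∀ z ∈ A, z + 1 < k) :
    per ((insert k A : Finset ℕ) : Set ℕ) = k + per (A : Set ℕ) := by
  refine per_eq_of_eq_insert (finite_boundary A) ?_ fun h => ?_
  · ext z
    simp only [boundary, Set.mem_ofPred_eq, Finset.mem_coe, Finset.mem_insert, Set.mem_insert_iff]
    constructor
    · rintro ⟨rfl | h1, h2⟩
      · exact Or.inl rfl
      · refine Or.inr ⟨h1, ?_⟩
        rintro ⟨⟨y, hy, rfl⟩, h4⟩
        exact h2 ⟨⟨y, Or.inr hy, rfl⟩, Or.inr h4⟩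
    · rintro (rfl | ⟨h1, h2⟩)
      · refine ⟨Or.inl rfl, ?_⟩
        rintro ⟨-, h | h⟩
        · omega
        · have := hA _ h; omega
      · have := hA z h1
        refine ⟨Or.inr h1, ?_⟩
        rintro ⟨⟨y, rfl | hy, rfl⟩, h4⟩
        · omega
        · refine h2 ⟨⟨y, hy, rfl⟩, ?_⟩
          rcases h4 with h4 | h4
          · omega
          · exact h4
  · have := hA _ (boundary_subset _ h)
    omega

/-! ### Extremal sets, and lower bounds for `P` and `Q` by `f` -/

theorem mem_le_vol {A : Finset ℕ} {z : ℕ} (hz : z ∈ A) : z ≤ vol A :=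
  Finset.single_le_sum (f := fun z => z) (fun _ _ => Nat.zero_le _) hz

theorem exists_vol_per_eq_P (n : ℕ) : ∃ A : Finset ℕ, vol A = n ∧ per (A : Set ℕ) = P n :=
  (P_isLeast n).1

theorem exists_vol_per_compl_eq_Q (n : ℕ) :
    ∃ A : Finset ℕ, vol A = n ∧ per ((A : Set ℕ)ᶜ) = Q n :=
  (Q_isLeast n).1

theorem P_vol_le (A : Finset ℕ) : P (vol A) ≤ per (A : Set ℕ) := (P_isLeast _).2 ⟨A, rfl, rfl⟩

theorem Q_vol_le (A : Finset ℕ) : Q (vol A) ≤ per ((A : Set ℕ)ᶜ) := (Q_isLeast _).2 ⟨A, rfl, rfl⟩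

theorem P_le_self (n : ℕ) : P n ≤ n := by
  simpa [vol] using (P_vol_le {n}).trans (per_coe_le_vol {n})

theorem f_zero : f 0 = 0 := by
  simp only [f, Nat.cast_zero, mul_zero, Real.sqrt_zero, zero_add]
  exact Nat.floor_eq_zero.2 (by norm_num)

/-- So `f m` is the least `k` for which `{0, …, k}` has volume at least `m`, hence a lower bound for
the maximum of a set of volume `m`. -/
theorem f_le_iff {m k : ℕ} : f m ≤ k ↔ 2 * m ≤ k * (k + 1) := by
  obtain ⟨h1, h2⟩ := f_bounds m
  constructor
  · intro h
    exact h1.trans (Nat.mul_le_mul h (by omega))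
  · intro h
    rcases Nat.eq_zero_or_pos m with rfl | hm
    · simp [f_zero]
    · have := h2 hm
      by_contra! hc
      obtain ⟨d, hd⟩ := Nat.exists_eq_add_of_lt hc
      rw [hd] at this
      nlinarith

theorem g_lt_f {n : ℕ} (hn : 0 < n) : g n < f n := by
  have h := g_add n
  have h2 := (f_bounds n).2 hn
  nlinarith

theorem subset_range_of_vol_lt {B : Finset ℕ} {k : ℕ} (h : vol B < k) : B ⊆ Finset.range k :=
  fun _ hz => Finset.mem_range.2 ((mem_le_vol hz).trans_lt h)

theorem Q_zero : Q 0 = 0 := by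
  have h := Q_vol_le ∅
  have : per (((∅ : Finset ℕ) : Set ℕ)ᶜ) ≤ 0 + per ((∅ : Finset ℕ) : Set ℕ) := by
    refine per_le_of_subset (finite_boundary ∅) ?_
    rintro z ⟨-, h⟩
    by_contra hz
    simp only [Set.mem_insert_iff, not_or] at hz
    exact h ⟨⟨z - 1, by simp, by omega⟩, by simp⟩
  have h0 := per_coe_le_vol ∅
  simp only [vol, Finset.sum_empty] at h h0
  omega

theorem P_zero : P 0 = 0 := Nat.le_zero.1 (P_le_self 0)

theorem exists_max {A : Finset ℕ} (hA : A.Nonempty) :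
    ∃ k ∈ A, ∃ B ⊆ Finset.range k, A = Finset.range (k + 1) \ B ∧
      2 * (vol A + vol B) = k * (k + 1) := by
  have hmax : ∀ z ∈ A, z ≤ A.max' hA := fun z hz => A.le_max' z hz
  have hmem := A.max'_mem hA
  generalize A.max' hA = k at *
  have hsub : A ⊆ Finset.range (k + 1) := fun z hz => by
    have := hmax z hz; simp; omega
  refine ⟨k, hmem, Finset.range (k + 1) \ A, ?_, ?_, ?_⟩
  · intro z
    simp only [Finset.mem_sdiff, Finset.mem_range]
    rintro ⟨h1, h2⟩
    have : z ≠ k := by rintro rfl; exact h2 hmem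
    omega
  · rw [Finset.sdiff_sdiff_eq_self hsub]
  · rw [add_comm, two_mul_vol_sdiff hsub]

theorem nonempty_of_vol_pos {A : Finset ℕ} (h : 0 < vol A) : A.Nonempty := by
  rw [Finset.nonempty_iff_ne_empty]
  rintro rfl
  simp [vol] at h

theorem f_vol_le_per (A : Finset ℕ) : f (vol A) ≤ per (A : Set ℕ) := by
  rcases Nat.eq_zero_or_pos (vol A) with h | h
  · simp [h, f_zero]
  obtain ⟨k, hk, B, hB, hAB, hv⟩ := exists_max (nonempty_of_vol_pos h)
  have hf : f (vol A) ≤ k := f_le_iff.2 (by omega)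
  refine hf.trans (le_per (finite_boundary A) ⟨hk, fun h => ?_⟩)
  have := h.2
  rw [hAB] at this
  simp at this

theorem f_vol_lt_per_compl {A : Finset ℕ} (h : 0 < vol A) : f (vol A) < per ((A : Set ℕ)ᶜ) := by
  obtain ⟨k, hk, B, hB, hAB, hv⟩ := exists_max (nonempty_of_vol_pos h)
  have hf : f (vol A) ≤ k := f_le_iff.2 (by omega)
  have := per_compl_sdiff hB
  rw [← hAB] at this
  omega

theorem f_le_P (n : ℕ) : f n ≤ P n := by
  obtain ⟨A, rfl, h⟩ := exists_vol_per_eq_P n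
  exact h ▸ f_vol_le_per A

theorem f_lt_Q {n : ℕ} (hn : 0 < n) : f n < Q n := by
  obtain ⟨A, rfl, h⟩ := exists_vol_per_compl_eq_Q n
  exact h ▸ f_vol_lt_per_compl hn

/-! ### Upper bounds for `P` and `Q` -/

/-- Upper bounds for the first values of `P`. -/
def upperP : List ℕ :=
  [0, 1, 2, 2, 4, 5, 3, 6, 7, 6, 4, 11, 8, 9, 7, 5, 11, 12, 9, 10, 8, 6, 11, 12, 13, 10,
   11, 9, 7, 15, 12, 13, 14, 11, 12, 10, 8, 16, 16, 13, 14, 15, 12, 13, 11, 9, 16, 17, 17,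
   14, 15, 16, 13, 14, 12, 10, 16, 17, 18, 18]

/-- Upper bounds for the first values of `Q`. -/
def upperQ : List ℕ :=
  [0, 2, 4, 3, 6, 5, 4, 7, 7, 6, 5, 10, 8, 8, 7, 6, 12, 11, 9, 9, 8, 7, 11, 13, 12, 10,
   10, 9, 8, 15, 12, 14, 13, 11, 11, 10, 9, 17, 16, 13, 15, 14, 12, 12, 11, 10, 17, 18,
   17, 14, 16, 15, 13, 13, 12, 11, 16, 18, 19, 18]

theorem P_le_of_eq {n k m : ℕ} (h : 2 * (n + m) = k * (k + 1)) (hm : m < k) :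
    P n ≤ k + Q m := by
  obtain ⟨B, hB, hQ⟩ := exists_vol_per_compl_eq_Q m
  have hsub : B ⊆ Finset.range k := subset_range_of_vol_lt (hB ▸ hm)
  have hv := two_mul_vol_sdiff (hsub.trans (Finset.range_subset_range.2 (Nat.le_succ _)))
  have hA : vol (Finset.range (k + 1) \ B) = n := by omega
  rw [← hQ]
  conv_lhs => rw [← hA]
  exact (P_vol_le _).trans per_sdiff_le

theorem Q_le_of_eq {n k m : ℕ} (h : 2 * (n + m) = k * (k + 1)) (hm : m < k) :
    Q n ≤ k + 1 + P m := by
  obtain ⟨B, hB, hP⟩ := exists_vol_per_eq_P m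
  have hsub : B ⊆ Finset.range k := subset_range_of_vol_lt (hB ▸ hm)
  have hv := two_mul_vol_sdiff (hsub.trans (Finset.range_subset_range.2 (Nat.le_succ _)))
  have hA : vol (Finset.range (k + 1) \ B) = n := by omega
  rw [← hP]
  conv_lhs => rw [← hA]
  exact (Q_vol_le _).trans (per_compl_sdiff hsub).le

theorem P_le_f_add (n : ℕ) : P n ≤ f n + Q (g n) := by
  rcases Nat.eq_zero_or_pos n with rfl | hn
  · simp [P_zero]
  · exact P_le_of_eq (by rw [add_comm, g_add]) (g_lt_f hn)

theorem Q_le_f_add {n : ℕ} (hn : 0 < n) : Q n ≤ f n + 1 + P (g n) :=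
  Q_le_of_eq (by rw [add_comm, g_add]) (g_lt_f hn)

/-- The element `0` adds no volume or perimeter but keeps `1` off the boundary. -/
theorem P_seven_le : P 7 ≤ 6 := by
  have h := P_vol_le {0, 1, 2, 4}
  rw [per_coe] at h
  exact h.trans (by decide)

theorem P_eight_le : P 8 ≤ 7 := by
  have h := P_vol_le {0, 1, 2, 5}
  rw [per_coe] at h
  exact h.trans (by decide)

theorem le_upper (n : ℕ) (hn : n < 60) : P n ≤ upperP.getD n 0 ∧ Q n ≤ upperQ.getD n 0 := by
  induction n using Nat.strong_induction_on with
  | _ n ih =>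
    rcases Nat.eq_zero_or_pos n with rfl | hpos
    · simp [P_zero, Q_zero]
    -- Complementation yields every table entry except four values of `P`: singletons serve 2 and 4,
    -- explicit sets serve 7 and 8.
    have key : ∀ n < 60, n = 0 ∨ ∃ k < 12, ∃ m < k, 2 * (n + m) = k * (k + 1) ∧ m < n ∧
        (k + upperQ.getD m 0 ≤ upperP.getD n 0 ∨
          n ∈ [2, 4] ∧ n ≤ upperP.getD n 0 ∨ n = 7 ∨ n = 8) ∧
        k + 1 + upperP.getD m 0 ≤ upperQ.getD n 0 := by decide +kernel
    obtain ⟨k, -, m, hmk, hk, hmn, hP, hQ⟩ := (key n hn).resolve_left hpos.ne'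
    obtain ⟨ihP, ihQ⟩ := ih m hmn (by omega)
    have h1 := P_le_of_eq hk hmk
    have h2 := Q_le_of_eq hk hmk
    refine ⟨?_, by omega⟩
    rcases hP with h | ⟨-, h⟩ | rfl | rfl
    · omega
    · exact (P_le_self n).trans h
    · exact P_seven_le
    · exact P_eight_le

/-- Here `f 704 = 38` and the table gives only 55, one too many for `upper_check` at `F = 705`.
Taking maximum 39 instead gives `39 + 13 + 2`. -/
theorem P_704_le : P 704 ≤ 54 := by
  have hB : (Finset.range (12 + 1) \ {2}) ⊆ Finset.range 39 :=
    Finset.sdiff_subset.trans (Finset.range_subset_range.2 (by norm_num))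
  have h1 := P_vol_le (Finset.range (39 + 1) \ (Finset.range (12 + 1) \ {2}))
  have h2 := per_sdiff_le (k := 39) (B := Finset.range (12 + 1) \ {2})
  have h3 := per_compl_sdiff (k := 12) (B := {2}) (by simp)
  have h4 := per_coe_le_vol {2}
  have h5 := two_mul_vol_sdiff (k := 12) (B := {2}) (by simp)
  have h6 := two_mul_vol_sdiff (hB.trans (Finset.range_subset_range.2 (Nat.le_succ _)))
  have h7 : vol {2} = 2 := rfl
  rw [h7] at h5 h4
  have h8 : vol (Finset.range (39 + 1) \ (Finset.range (12 + 1) \ {2})) = 704 := by omega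
  rw [h8] at h1
  omega

theorem four_mul_le (n : ℕ) : 4 * P n ≤ n + 33 ∧ 4 * Q n ≤ n + 33 := by
  induction n using Nat.strong_induction_on with
  | _ n ih =>
    rcases Nat.lt_or_ge n 60 with h | h
    · have key : ∀ n < 60, 4 * upperP.getD n 0 ≤ n + 33 ∧ 4 * upperQ.getD n 0 ≤ n + 33 := by
        decide +kernel
      have h1 := key n h
      have h2 := le_upper n h
      omega
    · have hn : 0 < n := by omega
      obtain ⟨h1, h2⟩ := ih _ (g_lt hn)
      have h3 := P_le_f_add n
      have h4 := Q_le_f_add hn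
      have h5 := g_lt_f hn
      have h6 := (f_bounds n).2 hn
      -- This closes the induction because `g n < f n`; it holds from 58 on, hence the table up to
      -- 60.
      have h7 : 5 * f n + 3 ≤ n := by
        by_contra hc
        have : f n ≤ 11 := by nlinarith
        omega
      omega

theorem eq_sub_of_f_eq_of_g_eq {n φ r : ℕ} (h1 : f n = φ) (h2 : g n = r) :
    n = φ * (φ + 1) / 2 - r := by
  have := g_add n
  rw [h1, h2] at this
  omega

/-- `φ` and `r` stand for `f G` and `g G`, and `F` is the least value allowed with this `G` in
`P_Q_le_f_add`. All indices are below 60, so the default of `getD` is never used. -/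
theorem upper_check : ∀ φ < 60, ∀ r < φ,
    let G := φ * (φ + 1) / 2 - r
    let F := if G ≤ 531 then 548 else max 549 (G + 1)
    ((φ + upperQ.getD r 0 - 2) * (φ + upperQ.getD r 0 - 1) < 2 * (G + F + 1) ∨ G = 704) ∧
    (φ + 1 + upperP.getD r 0 - 3) * (φ + 1 + upperP.getD r 0 - 2) < 2 * (G + F + 1) := by
  decide +kernel

theorem P_Q_le_f_add {F G : ℕ} (hF : 548 ≤ F) (hG : G < F) (h : F = 548 → G ≤ 531) :
    P G ≤ f (G + F + 1) + 1 ∧ Q G ≤ f (G + F + 1) + 2 := by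
  -- With `c = f (G + F + 1)`, `c (c + 1) ≥ 2 (G + F + 1)`, so these quadratic bounds rule out `c ≤
  -- P G - 2` and `c ≤ Q G - 3`.
  suffices H : (P G - 2) * (P G - 1) < 2 * (G + F + 1) ∧
      (Q G - 3) * (Q G - 2) < 2 * (G + F + 1) by
    obtain ⟨H1, H2⟩ := H
    have H3 := (f_bounds (G + F + 1)).1
    generalize f (G + F + 1) = c at *
    constructor
    · by_contra hc
      have := Nat.mul_le_mul (show c ≤ P G - 2 by omega) (show c + 1 ≤ P G - 1 by omega)
      omega
    · by_contra hc
      have := Nat.mul_le_mul (show c ≤ Q G - 3 by omega) (show c + 1 ≤ Q G - 2 by omega)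
      omega
  rcases Nat.eq_zero_or_pos G with rfl | hpos
  · simp [P_zero, Q_zero]
  have h3 := P_le_f_add G
  have h4 := Q_le_f_add hpos
  have h5 := g_lt_f hpos
  rcases Nat.lt_or_ge (f G) 60 with hf | hf
  · obtain ⟨c1, c2⟩ := upper_check _ hf _ h5
    obtain ⟨u1, u2⟩ := le_upper (g G) (by omega)
    rw [← eq_sub_of_f_eq_of_g_eq rfl rfl] at c1 c2
    have hFm : (if G ≤ 531 then 548 else max 549 (G + 1)) ≤ F := by
      split_ifs <;> omega
    generalize (if G ≤ 531 then 548 else max 549 (G + 1)) = F' at *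
    constructor
    · rcases c1 with c1 | rfl
      · refine (Nat.mul_le_mul (Nat.sub_le_sub_right ?_ 2) (Nat.sub_le_sub_right ?_ 1)).trans_lt
          (c1.trans_le (by omega)) <;> omega
      · refine (Nat.mul_le_mul (Nat.sub_le_sub_right P_704_le 2)
          (Nat.sub_le_sub_right P_704_le 1)).trans_lt ?_
        omega
    · refine (Nat.mul_le_mul (Nat.sub_le_sub_right ?_ 3) (Nat.sub_le_sub_right ?_ 2)).trans_lt
          (c2.trans_le (by omega)) <;> omega
  · obtain ⟨h1, h2⟩ := four_mul_le (g G)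
    have h6 := (f_bounds G).2 hpos
    -- The product is about `25/16 · (f G)²`, while `F > G` makes the right side exceed `4G`, about
    -- `2 (f G)²`.
    have aux : ∀ a b : ℕ, a + 1 = b → 4 * b ≤ 5 * f G + 28 → a * b < 2 * (G + F + 1) := by
      rintro a b rfl hb
      nlinarith
    constructor
    · rcases Nat.lt_or_ge (P G) 2 with hp | hp
      · rw [Nat.sub_eq_zero_of_le (by omega)]; omega
      · exact aux _ _ (by omega) (by omega)
    · rcases Nat.lt_or_ge (Q G) 3 with hp | hp
      · rw [Nat.sub_eq_zero_of_le (by omega)]; omega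
      · exact aux _ _ (by omega) (by omega)

/-! ### The recursion above the threshold -/

theorem f_mono {a b : ℕ} (h : a ≤ b) : f a ≤ f b :=
  f_le_iff.2 ((Nat.mul_le_mul_left 2 h).trans (f_bounds b).1)

/-- For `n > 149894`, the hypotheses of `P_Q_le_f_add` hold with `F = f n` and `G = g n`. -/
theorem f_g_of_lt {n : ℕ} (hn : 149894 < n) :
    548 ≤ f n ∧ g n < f n ∧ (f n = 548 → g n ≤ 531) := by
  have h1 := g_add n
  have h2 := g_lt_f (n := n) (by omega)
  refine ⟨?_, h2, fun h => ?_⟩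
  · by_contra hc
    have := f_le_iff.1 (show f n ≤ 547 by omega)
    omega
  -- `548 · 549 / 2 - 149895 = 531`.
  · rw [h] at h1
    omega

theorem Q_eq_of_lt {n : ℕ} (hn : 149894 < n) : Q n = f n + 1 + P (g n) := by
  obtain ⟨hF, hG, hFG⟩ := f_g_of_lt hn
  refine le_antisymm (Q_le_f_add (by omega)) ?_
  have hP := (P_Q_le_f_add hF hG hFG).1
  have hg := g_add n
  obtain ⟨A, rfl, hA⟩ := exists_vol_per_compl_eq_Q n
  obtain ⟨k, hk, B, hB, hAB, hv⟩ := exists_max (nonempty_of_vol_pos (A := A) (by omega))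
  have hper := per_compl_sdiff hB
  rw [← hAB, hA] at hper
  have hfk : f (vol A) ≤ k := f_le_iff.2 (by omega)
  have hPB := P_vol_le B
  generalize f (vol A) = F at *
  generalize g (vol A) = G at *
  rcases hfk.eq_or_lt with rfl | hlt
  · rw [show vol B = G by omega] at hPB
    omega
  · have h1 : G + F + 1 ≤ vol B := by nlinarith
    have := f_mono h1
    have := f_le_P (vol B)
    omega

theorem P_eq_of_lt {n : ℕ} (hn : 149894 < n) : P n = f n + Q (g n) := by
  obtain ⟨hF, hG, hFG⟩ := f_g_of_lt hn
  refine le_antisymm (P_le_f_add n) ?_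
  have hQ := (P_Q_le_f_add hF hG hFG).2
  have hg := g_add n
  have hfb := (f_bounds n).2 (by omega)
  obtain ⟨A, rfl, hA⟩ := exists_vol_per_eq_P n
  obtain ⟨k, hk, B, hB, hAB, hv⟩ := exists_max (nonempty_of_vol_pos (A := A) (by omega))
  have hfk : f (vol A) ≤ k := f_le_iff.2 (by omega)
  have hk0 : 0 < k := by omega
  by_cases hkA : k - 1 ∈ A
  · have hB' : B ⊆ Finset.range (k - 1) := by
      intro z hz
      have h1 := Finset.mem_range.1 (hB hz)
      have h2 : z ≠ k - 1 := by
        rintro rfl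
        rw [hAB] at hkA
        exact (Finset.mem_sdiff.1 hkA).2 hz
      exact Finset.mem_range.2 (by omega)
    have hper := per_sdiff hk0 hB'
    rw [← hAB, hA] at hper
    have hQB := Q_vol_le B
    generalize f (vol A) = F at *
    generalize g (vol A) = G at *
    rcases hfk.eq_or_lt with rfl | hlt
    · rw [show vol B = G by omega] at hQB
      omega
    · have h1 : G + F + 1 ≤ vol B := by nlinarith
      have := f_mono h1
      have := f_lt_Q (n := vol B) (by omega)
      omega
  · have hlt : ∀ z ∈ A.erase k, z + 1 < k := by
      intro z hz
      obtain ⟨h1, h2⟩ := Finset.mem_erase.1 hz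
      have h3 : z ≠ k - 1 := by rintro rfl; exact hkA h2
      rw [hAB] at h2
      have := Finset.mem_range.1 (Finset.mem_sdiff.1 h2).1
      omega
    have hper := per_insert_of_lt hlt
    rw [Finset.insert_erase hk, hA] at hper
    have hvol : vol A = k + vol (A.erase k) := (Finset.add_sum_erase A (fun z => z) hk).symm
    have hle := f_vol_le_per (A.erase k)
    have hfb' := (f_bounds (vol (A.erase k))).1
    have hfF : f (g (vol A) + f (vol A) + 1) ≤ f (vol A) - 10 := by
      obtain ⟨d, hd⟩ := Nat.exists_eq_add_of_le hF
      refine f_le_iff.2 ?_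
      rw [hd, show 548 + d - 10 = 538 + d by omega]
      nlinarith
    generalize f (vol A) = F at *
    generalize g (vol A) = G at *
    generalize f (vol (A.erase k)) = c at *
    generalize f (G + F + 1) = e at *
    have : 2 * F - 8 ≤ k + c := by
      by_contra hc
      obtain ⟨d, rfl⟩ := Nat.exists_eq_add_of_le (show c + 8 ≤ F by omega)
      have : k ≤ c + 7 + 2 * d := by omega
      nlinarith
    omega

end IntIso

theorem proposition6p6 (n : ℕ) :
    (Even (IntIso.phi 149894 n) →
      IntIso.P n = IntIso.P (IntIso.g^[IntIso.phi 149894 n] n)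
        + ∑ i ∈ Finset.Icc 1 (IntIso.phi 149894 n), IntIso.f (IntIso.g^[i - 1] n)
        + IntIso.phi 149894 n / 2) ∧
    (Odd (IntIso.phi 149894 n) →
      IntIso.P n = IntIso.Q (IntIso.g^[IntIso.phi 149894 n] n)
        + ∑ i ∈ Finset.Icc 1 (IntIso.phi 149894 n), IntIso.f (IntIso.g^[i - 1] n)
        + (IntIso.phi 149894 n - 1) / 2) ∧
    (Even (IntIso.phi 149894 n) →
      IntIso.Q n = IntIso.Q (IntIso.g^[IntIso.phi 149894 n] n)
        + ∑ i ∈ Finset.Icc 1 (IntIso.phi 149894 n), IntIso.f (IntIso.g^[i - 1] n)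
        + IntIso.phi 149894 n / 2) ∧
    (Odd (IntIso.phi 149894 n) →
      IntIso.Q n = IntIso.P (IntIso.g^[IntIso.phi 149894 n] n)
        + ∑ i ∈ Finset.Icc 1 (IntIso.phi 149894 n), IntIso.f (IntIso.g^[i - 1] n)
        + (IntIso.phi 149894 n + 1) / 2) := by
  open IntIso in
  induction n using Nat.strong_induction_on with
  | _ n ih =>
    rcases Nat.lt_or_ge 149894 n with hn | hn
    · have hphi : phi 149894 n = phi 149894 (g n) + 1 := by
        obtain ⟨h1, h2⟩ := phi_isLeast 149894 n
        obtain ⟨h3, h4⟩ := phi_isLeast 149894 (g n)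
        refine le_antisymm (h2 (show g^[_ + 1] n ≤ _ from h3)) ?_
        rcases h : phi 149894 n with _ | j
        · rw [h] at h1
          exact absurd (show n ≤ 149894 from h1) (by omega)
        · rw [h] at h1
          exact Nat.succ_le_succ (h4 h1)
      have hsum : ∑ i ∈ Finset.Icc 1 (phi 149894 n), f (g^[i - 1] n) =
          f n + ∑ i ∈ Finset.Icc 1 (phi 149894 (g n)), f (g^[i - 1] (g n)) := by
        have h (N m : ℕ) : ∑ i ∈ Finset.Icc 1 N, f (g^[i - 1] m) =
            ∑ i ∈ Finset.range N, f (g^[i] m) := by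
          rw [Finset.range_eq_Ico]
          exact (Finset.sum_Ico_add' (fun i => f (g^[i - 1] m)) 0 N 1).symm
        rw [h, h, hphi, Finset.sum_range_succ', add_comm]
        rfl
      have hit : g^[phi 149894 n] n = g^[phi 149894 (g n)] (g n) := by rw [hphi]; rfl
      obtain ⟨i1, i2, i3, i4⟩ := ih (g n) (g_lt (by omega))
      rw [hsum, hit, P_eq_of_lt hn, Q_eq_of_lt hn, hphi]
      refine ⟨fun h => ?_, fun h => ?_, fun h => ?_, fun h => ?_⟩
      · have h' : Odd (phi 149894 (g n)) := by simpa [parity_simps] using h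
        rw [i4 h']; omega
      · have h' : Even (phi 149894 (g n)) := by simpa [parity_simps] using h
        rw [i3 h']; omega
      · have h' : Odd (phi 149894 (g n)) := by simpa [parity_simps] using h
        rw [i2 h']
        obtain ⟨t, ht⟩ := h'
        omega
      · have h' : Even (phi 149894 (g n)) := by simpa [parity_simps] using h
        rw [i1 h']; omega
    · have hphi : phi 149894 n = 0 := Nat.le_zero.1 ((phi_isLeast 149894 n).2 (show n ≤ _ from hn))
      rw [hphi]
      simp
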